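/- For an integer $i\ge 1$, let $\Sigma_i$ (respectively $\Pi_i$) be the set of first-order formulas in negation normal form (not necessarily prenex) in which every sequence of nested quantifiers begins with $\exists$ (respectively $\forall$) and has at most $i-1$ quantifier alternations. A $c$-colored graph is a finite simple undirected graph in which every vertex has one of $c$ colors; it is regarded as a structure with a binary adjacency relation and $c$ unary color relations, and formulas may also use equality. For colored graphs $G$ and $H$ and a fragment $\mathcal L$, let $D^2_{\mathcal L}(G,H)$ be the minimum quantifier depth of a sentence in $\mathcal L$ that uses at most two variables (which may be requantified), is true on $G$ and is false on $H$; put $D^2_{\mathcal L}(G,H)=\infty$ if there is no such sentence. There is a constant number of colors $c$ such that the following holds. For every $i\ge 2$ there are constants $K$ and $\varepsilon>0$, depending only on $i$, such that for infinitely many $n$ there are $c$-colored graphs $G$ and $H$, both with $n$ vertices, satisfying $$D^2_{\Sigma_i}(G,H)\le K,\qquad D^2_{\Sigma_{i-1}}(G,H)<\infty,\qquad D^2_{\Pi_i}(G,H)\ge \varepsilon n^2 .$$ -/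

import Mathlib

open scoped ENNReal

namespace AltHier

/-- A finite or infinite simple graph on `V` whose vertices are colored with `c` colors,
viewed as a structure with a binary adjacency relation and one unary relation per color. -/
structure ColoredGraph (c : ℕ) (V : Type*) where
  graph : SimpleGraph V
  color : V → Fin c

/-- The two kinds of quantifiers. -/
inductive Quantifier where
  | ex
  | all
  deriving DecidableEq

/-- Atomic formulas over the vocabulary of `c`-colored graphs in the variables `x₀, …, x_{k-1}`. -/
inductive Atom (c k : ℕ) where
  | color (j : Fin c) (x : Fin k)
  | adj (x y : Fin k)
  | eq (x y : Fin k)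

/-- First-order formulas in negation normal form using only `k` variables. Variables may be
quantified repeatedly. -/
inductive Formula (c k : ℕ) where
  | pos (a : Atom c k)
  | neg (a : Atom c k)
  | and (φ ψ : Formula c k)
  | or (φ ψ : Formula c k)
  | quant (Q : Quantifier) (x : Fin k) (φ : Formula c k)

/-- The variables occurring in an atomic formula. -/
def Atom.vars {c k : ℕ} : Atom c k → Finset (Fin k)
  | .color _ x => {x}
  | .adj x y => {x, y}
  | .eq x y => {x, y}

/-- Truth of an atomic formula under an assignment. -/
def Atom.Holds {c k : ℕ} {V : Type*} (G : ColoredGraph c V) (v : Fin k → V) : Atom c k → Prop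
  | .color j x => G.color (v x) = j
  | .adj x y => G.graph.Adj (v x) (v y)
  | .eq x y => v x = v y

namespace Formula

/-- The free variables of a formula. -/
def freeVars {c k : ℕ} : Formula c k → Finset (Fin k)
  | pos a => a.vars
  | neg a => a.vars
  | and φ ψ => φ.freeVars ∪ ψ.freeVars
  | or φ ψ => φ.freeVars ∪ ψ.freeVars
  | quant _ x φ => φ.freeVars.erase x

/-- Truth of a formula under an assignment. -/
def Holds {c k : ℕ} {V : Type*} (G : ColoredGraph c V) : (Fin k → V) → Formula c k → Prop
  | v, pos a => a.Holds G v
  | v, neg a => ¬ a.Holds G v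
  | v, and φ ψ => φ.Holds G v ∧ ψ.Holds G v
  | v, or φ ψ => φ.Holds G v ∨ ψ.Holds G v
  | v, quant .ex x φ => ∃ w : V, φ.Holds G (Function.update v x w)
  | v, quant .all x φ => ∀ w : V, φ.Holds G (Function.update v x w)

/-- Quantifier depth. -/
def depth {c k : ℕ} : Formula c k → ℕ
  | pos _ => 0
  | neg _ => 0
  | and φ ψ => max φ.depth ψ.depth
  | or φ ψ => max φ.depth ψ.depth
  | quant _ _ φ => φ.depth + 1

/-- Every sequence of nested quantifiers of the formula, read from the outside,
begins with the quantifier `Q` (or is empty). -/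
def BeginsWith {c k : ℕ} (Q : Quantifier) : Formula c k → Prop
  | pos _ => True
  | neg _ => True
  | and φ ψ => φ.BeginsWith Q ∧ ψ.BeginsWith Q
  | or φ ψ => φ.BeginsWith Q ∧ ψ.BeginsWith Q
  | quant Q' _ _ => Q' = Q

/-- `altAfter Q φ` is the maximum number of quantifier alternations in a sequence
`Q, Q₁, …, Q_r`, where `Q₁, …, Q_r` is a sequence of nested quantifiers of `φ`. -/
def altAfter {c k : ℕ} : Quantifier → Formula c k → ℕ
  | _, pos _ => 0
  | _, neg _ => 0
  | Q, and φ ψ => max (φ.altAfter Q) (ψ.altAfter Q)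
  | Q, or φ ψ => max (φ.altAfter Q) (ψ.altAfter Q)
  | Q, quant Q' _ φ => (if Q' = Q then 0 else 1) + φ.altAfter Q'

end Formula

/-- The formulas with `k` variables in which every sequence of nested quantifiers begins with `Q`
and has fewer than `i` (that is, at most `i - 1`) alternations, for `i ≥ 1`. Prefixing such a
sequence with a further `Q` does not change its number of alternations. -/
def level (c k : ℕ) (Q : Quantifier) (i : ℕ) : Set (Formula c k) :=
  {φ | φ.BeginsWith Q ∧ φ.altAfter Q < i}

/-- The fragment `Σ_i ∩ FO^k`, for `i ≥ 1`. -/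
def SigmaLevel (c k i : ℕ) : Set (Formula c k) := level c k .ex i

/-- The fragment `Π_i ∩ FO^k`, for `i ≥ 1`. -/
def PiLevel (c k i : ℕ) : Set (Formula c k) := level c k .all i

/-- `φ` is a sentence that is true on `G` and false on `H`. For a sentence the assignment does not
matter. -/
def Distinguishes {c k : ℕ} {V W : Type*} (φ : Formula c k)
    (G : ColoredGraph c V) (H : ColoredGraph c W) : Prop :=
  φ.freeVars = ∅ ∧ (∀ v : Fin k → V, φ.Holds G v) ∧ (∀ w : Fin k → W, ¬ φ.Holds H w)

/-- The minimum quantifier depth of a sentence in the fragment `L` distinguishing `G` from `H`;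
it is `⊤` if there is no such sentence. -/
noncomputable def distDepth {c k : ℕ} {V W : Type*} (L : Set (Formula c k))
    (G : ColoredGraph c V) (H : ColoredGraph c W) : ℕ∞ :=
  ⨅ φ ∈ {φ : Formula c k | φ ∈ L ∧ Distinguishes φ G H}, (φ.depth : ℕ∞)

end AltHier

/-! Put `i = m + 1`. Each graph is two copies of a full binary tree of height `m` with a gadget at
every node. An inner node has type `false` exactly when some child has type `true`, and only the
root type distinguishes `G` (`false`) from `H` (`true`). In the two-pebble game, Spoiler carries a
difference of types one level down only by playing where the node is `false` and moving to a `true`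
child, so each further level costs an alternation.

A gadget is a directed cycle of length `3p` and a doubled directed cycle of length `3q`, where `p =
2r + 1` and `q = 2r`. Colors record the position modulo 3, hence the direction, and a mark. Vertex 0
of the simple cycle is marked only at leaves of type `true`; each position of the doubled cycle has
a marked and an unmarked vertex, except position 0, where both are unmarked.

A marked simple cycle can be detected in two ways: with one alternation and constant depth, by a
vertex whose successors are all marked (`shallowTest_leafTest`); or purely existentially, by a walk
of `3pq` steps that repeats its pattern of marks, which the doubled cycle can imitate only until
both cycles are at 0 simultaneously (`deepTest_leafTest`). In a `Σ_i` game Spoiler starts on `G` and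
reaches the leaves with one alternation left; in `Σ_{i-1}` none is left, but the long walk still
wins. In `Π_i` he starts on `H`, spends one alternation to get to `G`, and is forced into the walk,
so the depth is quadratic in `r` (`le_distDepth_piLevel`). As `m` is fixed, the number of vertices
is linear in `r`. -/

namespace AltHier

/-! ### Syntax: negation and two-variable modal operators -/

/-- The dual quantifier. -/
def Quantifier.dual : Quantifier → Quantifier
  | .ex => .all
  | .all => .ex

theorem Quantifier.dual_dual (Q : Quantifier) : Q.dual.dual = Q := by cases Q <;> rfl

namespace Formula

variable {c k : ℕ}

/-- The negation of a formula, in negation normal form. -/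
def dual : Formula c k → Formula c k
  | pos a => neg a
  | neg a => pos a
  | and φ ψ => or φ.dual ψ.dual
  | or φ ψ => and φ.dual ψ.dual
  | quant Q x φ => quant Q.dual x φ.dual

theorem holds_dual {V : Type*} (G : ColoredGraph c V) (φ : Formula c k) (v : Fin k → V) :
    φ.dual.Holds G v ↔ ¬ φ.Holds G v := by
  induction φ generalizing v with
  | pos a => simp [dual, Holds]
  | neg a => simp [dual, Holds]
  | and φ ψ h1 h2 => simp only [dual, Holds, h1, h2]; tauto
  | or φ ψ h1 h2 => simp only [dual, Holds, h1, h2]; tauto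
  | quant Q x φ h => cases Q <;> simp [dual, Quantifier.dual, Holds, h]

theorem freeVars_dual (φ : Formula c k) : φ.dual.freeVars = φ.freeVars := by
  induction φ with
  | pos a => rfl
  | neg a => rfl
  | and φ ψ h1 h2 => simp [dual, freeVars, h1, h2]
  | or φ ψ h1 h2 => simp [dual, freeVars, h1, h2]
  | quant Q x φ h => simp [dual, freeVars, h]

theorem altAfter_dual (φ : Formula c k) (Q : Quantifier) :
    φ.dual.altAfter Q = φ.altAfter Q.dual := by
  induction φ generalizing Q with
  | pos a => rfl
  | neg a => rfl
  | and φ ψ h1 h2 => simp [dual, altAfter, h1, h2]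
  | or φ ψ h1 h2 => simp [dual, altAfter, h1, h2]
  | quant Q' x φ h =>
    simp only [dual, altAfter, h, Quantifier.dual_dual]
    cases Q <;> cases Q' <;> simp [Quantifier.dual]

theorem altAfter_le (φ : Formula c k) (Q Q' : Quantifier) :
    φ.altAfter Q ≤ φ.altAfter Q' + 1 := by
  induction φ generalizing Q Q' with
  | pos a => simp [altAfter]
  | neg a => simp [altAfter]
  | and φ ψ h1 h2 => have := h1 Q Q'; have := h2 Q Q'; simp only [altAfter]; omega
  | or φ ψ h1 h2 => have := h1 Q Q'; have := h2 Q Q'; simp only [altAfter]; omega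
  | quant Q'' x φ h => simp only [altAfter]; split_ifs <;> omega

end Formula

section Unary

variable {c : ℕ} {V : Type*}

/-- `F x` has no free variable but `x`. -/
def IsUnary (F : Fin 2 → Formula c 2) : Prop := ∀ x, (F x).freeVars ⊆ {x}

/-- `F x` expresses in `G` that the value of `x` satisfies `P`. -/
def Defines (G : ColoredGraph c V) (F : Fin 2 → Formula c 2) (P : V → Prop) : Prop :=
  ∀ v x, (F x).Holds G v ↔ P (v x)

/-- Some neighbour of color `j` satisfies `F`. -/
def dia (j : Fin c) (F : Fin 2 → Formula c 2) (x : Fin 2) : Formula c 2 :=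
  .quant .ex (x + 1) (.and (.pos (.adj x (x + 1))) (.and (.pos (.color j (x + 1))) (F (x + 1))))

/-- No neighbour has color `j`. -/
def noNeighbor (j : Fin c) (x : Fin 2) : Formula c 2 :=
  .quant .all (x + 1) (.or (.neg (.adj x (x + 1))) (.neg (.color j (x + 1))))

theorem isUnary_dia {j : Fin c} {F : Fin 2 → Formula c 2} (h : IsUnary F) : IsUnary (dia j F) := by
  intro x a ha
  have := @h (x + 1) a
  simp only [dia, Formula.freeVars, Atom.vars, Finset.mem_erase, Finset.mem_union,
    Finset.mem_insert, Finset.mem_singleton] at ha this ⊢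
  tauto

theorem isUnary_noNeighbor (j : Fin c) : IsUnary (noNeighbor j) := by
  intro x a ha
  simp only [noNeighbor, Formula.freeVars, Atom.vars, Finset.mem_erase, Finset.mem_union,
    Finset.mem_insert, Finset.mem_singleton] at ha ⊢
  tauto

theorem isUnary_dual {F : Fin 2 → Formula c 2} (h : IsUnary F) : IsUnary (fun x => (F x).dual) :=
  fun x => by rw [Formula.freeVars_dual]; exact h x

theorem fin_two_ne_add_one (x : Fin 2) : x ≠ x + 1 := by revert x; decide

theorem eq_or_eq_add_one (x y : Fin 2) : y = x ∨ y = x + 1 := by revert x y; decide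

theorem defines_dia {G : ColoredGraph c V} {j : Fin c} {F : Fin 2 → Formula c 2} {P : V → Prop}
    (h : Defines G F P) :
    Defines G (dia j F) (fun u => ∃ w, G.graph.Adj u w ∧ G.color w = j ∧ P w) := by
  intro v x
  simp [dia, Formula.Holds, Atom.Holds, h _ _]

theorem defines_noNeighbor (G : ColoredGraph c V) (j : Fin c) :
    Defines G (noNeighbor j) (fun u => ∀ w, G.graph.Adj u w → G.color w ≠ j) := by
  intro v x
  simp [noNeighbor, Formula.Holds, Atom.Holds, imp_iff_not_or]

theorem defines_dual {G : ColoredGraph c V} {F : Fin 2 → Formula c 2} {P : V → Prop}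
    (h : Defines G F P) : Defines G (fun x => (F x).dual) (fun u => ¬ P u) := by
  intro v x
  rw [Formula.holds_dual, h]

/-- The sentence saying that some vertex of color `j` satisfies `F`. -/
def someVertex (j : Fin c) (F : Fin 2 → Formula c 2) : Formula c 2 :=
  .quant .ex 0 (.and (.pos (.color j 0)) (F 0))

theorem freeVars_someVertex {j : Fin c} {F : Fin 2 → Formula c 2} (h : IsUnary F) :
    (someVertex j F).freeVars = ∅ := by
  have := h 0
  ext a
  have := @this a
  simp only [someVertex, Formula.freeVars, Atom.vars, Finset.mem_erase, Finset.mem_union,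
    Finset.mem_singleton, Finset.notMem_empty, iff_false] at this ⊢
  tauto

theorem holds_someVertex {G : ColoredGraph c V} {j : Fin c} {F : Fin 2 → Formula c 2}
    {P : V → Prop} (h : Defines G F P) (v : Fin 2 → V) :
    (someVertex j F).Holds G v ↔ ∃ w, G.color w = j ∧ P w := by
  simp [someVertex, Formula.Holds, Atom.Holds, h _ _]

end Unary

/-! ### The two-pebble game with a bounded number of alternations -/

/-- A family of relations describing a strategy of Duplicator in the two-pebble game on the graphs
`M b` (where Spoiler plays next) and `M b'`. The index `j` bounds the number of
alternations that Spoiler has left, the index `t` the number of rounds. -/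
structure Strategy {c : ℕ} {V ι : Type*} (M : ι → ColoredGraph c V) (bound : ℕ) where
  start : ι → ι → ℕ → Prop
  rel : ι → ι → ℕ → ℕ → V → V → Prop
  start_swap : ∀ {b b' j}, start b b' (j + 1) → start b' b j
  rel_swap : ∀ {b b' j t u v}, rel b b' (j + 1) t u v → rel b' b j t v u
  rel_weaken : ∀ {b b' j t u v}, rel b b' j (t + 1) u v → rel b b' j t u v
  color_eq : ∀ {b b' j t u v}, rel b b' j t u v → (M b).color u = (M b').color v
  extend : ∀ {b b' j t u v u'}, rel b b' j (t + 1) u v → t + 1 ≤ bound →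
    (M b).graph.Adj u u' → ∃ v', (M b').graph.Adj v v' ∧ rel b b' j t u' v'
  jump : ∀ {b b' j t} (u v : V), start b b' j → t ≤ bound →
    ∃ v', v' ≠ v ∧ ¬ (M b').graph.Adj v v' ∧ rel b b' j t u v'

namespace Strategy

variable {c : ℕ} {V ι : Type*} {M : ι → ColoredGraph c V} {bound : ℕ}

/-- A position of the game that is good for Duplicator. -/
structure Good (S : Strategy M bound) (b b' : ι) (j t : ℕ) (v v' : Fin 2 → V) : Prop where
  start : S.start b b' j
  rel : ∀ x, S.rel b b' j t (v x) (v' x)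
  eq_iff : ∀ x y, v x = v y ↔ v' x = v' y
  adj_iff : ∀ x y, (M b).graph.Adj (v x) (v y) ↔ (M b').graph.Adj (v' x) (v' y)

theorem Good.swap {S : Strategy M bound} {b b' : ι} {j t : ℕ} {v v' : Fin 2 → V}
    (h : S.Good b b' (j + 1) t v v') : S.Good b' b j t v' v :=
  ⟨S.start_swap h.start, fun x => S.rel_swap (h.rel x), fun x y => (h.eq_iff x y).symm,
    fun x y => (h.adj_iff x y).symm⟩

theorem Good.holds_atom {S : Strategy M bound} {b b' : ι} {j t : ℕ} {v v' : Fin 2 → V}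
    (h : S.Good b b' j t v v') (a : Atom c 2) : a.Holds (M b) v ↔ a.Holds (M b') v' := by
  cases a with
  | color i x => simp [Atom.Holds, S.color_eq (h.rel x)]
  | adj x y => exact h.adj_iff x y
  | eq x y => exact h.eq_iff x y

theorem good_update {S : Strategy M bound} {b b' : ι} {j t : ℕ} {v v' : Fin 2 → V} {x : Fin 2}
    {w w' : V} (hs : S.start b b' j) (hr : S.rel b b' j t (v (x + 1)) (v' (x + 1)))
    (hw : S.rel b b' j t w w') (he : w = v (x + 1) ↔ w' = v' (x + 1))
    (ha : (M b).graph.Adj (v (x + 1)) w ↔ (M b').graph.Adj (v' (x + 1)) w') :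
    S.Good b b' j t (Function.update v x w) (Function.update v' x w') := by
  have hx : ∀ y : Fin 2, y = x ∨ y = x + 1 := eq_or_eq_add_one x
  have hne := (fin_two_ne_add_one x).symm
  refine ⟨hs, fun y => ?_, fun y z => ?_, fun y z => ?_⟩
  · rcases hx y with rfl | rfl <;> simp [*]
  · rcases hx y with rfl | rfl <;> rcases hx z with h | h <;> subst h <;>
      simp [hne, he, eq_comm (a := v (_ + 1)), eq_comm (a := v' (_ + 1))]
  · rcases hx y with rfl | rfl <;> rcases hx z with h | h <;> subst h <;>
      simp [hne, ha, SimpleGraph.adj_comm _ w, SimpleGraph.adj_comm _ w']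

/-- Only the pebble left in place constrains the answer: a move onto it is copied, a move along an
edge is followed by `extend`, and any other move is a fresh `jump`. -/
theorem Good.move {S : Strategy M bound} {b b' : ι} {j t : ℕ} {v v' : Fin 2 → V}
    (h : S.Good b b' j (t + 1) v v') (ht : t + 1 ≤ bound) (x : Fin 2) (w : V) :
    ∃ w', S.Good b b' j t (Function.update v x w) (Function.update v' x w') := by
  have hr := S.rel_weaken (h.rel (x + 1))
  by_cases he : w = v (x + 1)
  · exact ⟨v' (x + 1), good_update h.start hr (he ▸ hr) (by simp [he]) (by simp [he])⟩
  by_cases ha : (M b).graph.Adj (v (x + 1)) w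
  · obtain ⟨w', h1, h2⟩ := S.extend (h.rel (x + 1)) ht ha
    exact ⟨w', good_update h.start hr h2 (by simp [he, h1.ne']) (by simp [ha, h1])⟩
  · obtain ⟨w', h1, h2, h3⟩ := S.jump w (v' (x + 1)) h.start (by omega : t ≤ bound)
    exact ⟨w', good_update h.start hr h3 (by simp [he, h1]) (by simp [ha, h2])⟩

/-- The second half is the first one for the dual formula, contraposed. A quantifier that Spoiler
resolves on his current side is free; the other kind swaps the sides and uses up one of the `j`
alternations. -/
theorem Good.holds {S : Strategy M bound} (φ : Formula c 2) {b b' : ι} {j t : ℕ}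
    {v v' : Fin 2 → V} (h : S.Good b b' j t v v') (ht : t ≤ bound) (hd : φ.depth ≤ t) :
    (φ.altAfter .ex ≤ j → φ.Holds (M b) v → φ.Holds (M b') v') ∧
      (φ.altAfter .all ≤ j → φ.Holds (M b') v' → φ.Holds (M b) v) := by
  induction φ generalizing b b' j t v v' with
  | pos a => simp [Formula.Holds, h.holds_atom a]
  | neg a => simp [Formula.Holds, h.holds_atom a]
  | and φ ψ h1 h2 =>
    simp only [Formula.depth, Formula.altAfter, Formula.Holds, sup_le_iff] at hd ⊢
    have := h1 h ht hd.1
    have := h2 h ht hd.2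
    tauto
  | or φ ψ h1 h2 =>
    simp only [Formula.depth, Formula.altAfter, Formula.Holds, sup_le_iff] at hd ⊢
    have := h1 h ht hd.1
    have := h2 h ht hd.2
    tauto
  | quant Q x φ ih =>
    obtain ⟨t, rfl⟩ : ∃ s, t = s + 1 := ⟨t - 1, by simp only [Formula.depth] at hd; omega⟩
    have hd' : φ.depth ≤ t := by simp only [Formula.depth] at hd; omega
    cases Q with
    | ex =>
      simp only [Formula.altAfter, Formula.Holds]
      constructor
      · rintro hj ⟨w, hw⟩
        obtain ⟨w', hw'⟩ := h.move ht x w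
        exact ⟨w', (ih hw' (by omega) hd').1 (by simpa using hj) hw⟩
      · rintro hj ⟨w, hw⟩
        obtain ⟨j, rfl⟩ : ∃ s, j = s + 1 := ⟨j - 1, by simp at hj; omega⟩
        obtain ⟨w', hw'⟩ := h.swap.move ht x w
        exact ⟨w', (ih hw' (by omega) hd').1 (by simp at hj; omega) hw⟩
    | all =>
      simp only [Formula.altAfter, Formula.Holds]
      constructor
      · intro hj hw w
        obtain ⟨j, rfl⟩ : ∃ s, j = s + 1 := ⟨j - 1, by simp at hj; omega⟩
        obtain ⟨w', hw'⟩ := h.swap.move ht x w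
        exact (ih hw' (by omega) hd').2 (by simp at hj; omega) (hw w')
      · intro hj hw w
        obtain ⟨w', hw'⟩ := h.move ht x w
        exact (ih hw' (by omega) hd').2 (by simpa using hj) (hw w')

/-- A strategy of Duplicator bounds the depth of distinguishing sentences from below. -/
theorem lt_depth [Nonempty V] (S : Strategy M bound) {b b' : ι} {j : ℕ} (hs : S.start b b' j)
    {φ : Formula c 2} (hφ : φ.altAfter .all ≤ j) (h : Distinguishes φ (M b') (M b)) :
    bound < φ.depth := by
  by_contra! hd
  obtain ⟨u⟩ := ‹Nonempty V›
  -- The game starts with both pebbles on one vertex; only the relation supplied by the jump matters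
  -- here.
  obtain ⟨v, -, -, hv⟩ := S.jump u u hs le_rfl
  have hg : S.Good b b' j bound (fun _ => u) (fun _ => v) :=
    ⟨hs, fun _ => hv, by simp, by simp⟩
  exact h.2.2 _ ((hg.holds φ le_rfl hd).2 hφ (h.2.1 _))

end Strategy

/-! ### Isomorphic copies -/

/-- The copy of a colored graph along a bijection. -/
def ColoredGraph.copy {c : ℕ} {V W : Type*} (G : ColoredGraph c V) (e : V ≃ W) :
    ColoredGraph c W where
  graph := G.graph.comap e.symm
  color := G.color ∘ e.symm

theorem Formula.holds_copy {c k : ℕ} {V W : Type*} (G : ColoredGraph c V) (e : V ≃ W)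
    (φ : Formula c k) (v : Fin k → W) : φ.Holds (G.copy e) v ↔ φ.Holds G (e.symm ∘ v) := by
  induction φ generalizing v with
  | pos a => cases a <;> simp [Formula.Holds, Atom.Holds, ColoredGraph.copy]
  | neg a => cases a <;> simp [Formula.Holds, Atom.Holds, ColoredGraph.copy]
  | and φ ψ h1 h2 => simp [Formula.Holds, h1, h2]
  | or φ ψ h1 h2 => simp [Formula.Holds, h1, h2]
  | quant Q x φ h =>
    cases Q <;> simp only [Formula.Holds, h, Function.comp_update]
    · exact e.symm.exists_congr_left.trans (by simp)
    · exact e.symm.forall_congr_left.trans (by simp)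

theorem distinguishes_copy_iff {c k : ℕ} {V W : Type*} (G H : ColoredGraph c V) (e : V ≃ W)
    (φ : Formula c k) : Distinguishes φ (G.copy e) (H.copy e) ↔ Distinguishes φ G H := by
  have key : ∀ p : (Fin k → V) → Prop, (∀ v : Fin k → W, p (e.symm ∘ v)) ↔ ∀ v, p v :=
    fun p => ⟨fun h v => by simpa [← Function.comp_assoc] using h (e ∘ v), fun h v => h _⟩
  simp only [Distinguishes, Formula.holds_copy, key (fun v => φ.Holds G v),
    key (fun v => ¬ φ.Holds H v)]

theorem distDepth_copy {c k : ℕ} {V W : Type*} (L : Set (Formula c k)) (G H : ColoredGraph c V)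
    (e : V ≃ W) : distDepth L (G.copy e) (H.copy e) = distDepth L G H := by
  simp only [distDepth, distinguishes_copy_iff]

end AltHier

namespace AltHier

/-! ### The graphs -/

section Construction

/-- A directed cycle of length `3p` and a directed cycle of length `3q` with doubled vertices. -/
abbrev Comp (p q : ℕ) : Type := ZMod (3 * p) ⊕ ZMod (3 * q) × Bool

/-- Two copies of the full binary tree of height `m`, with a copy of `Comp p q` attached to every
node. -/
abbrev Vert (m p q : ℕ) : Type := Bool × {s : List Bool // s.length ≤ m} × Option (Comp p q)

/-- The position on a cycle modulo 3. -/
def cls (p : ℕ) : ZMod (3 * p) →+* ZMod 3 := ZMod.castHom (Dvd.intro p rfl) (ZMod 3)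

/-- The type of a node in the tree whose root has type `b`: a node has type `true` if and only if
it is a second child and its parent has type `false`. -/
def ty (b : Bool) : List Bool → Bool
  | [] => b
  | c :: s => c && !ty b s

/-- Whether a component contains the special vertex. -/
def special (m : ℕ) (b : Bool) (s : List Bool) : Bool := decide (s.length = m) && ty b s

/-- The color of a node at distance `n` from the root. -/
def nodeColor (n : ℕ) : Fin 10 := if n = 0 then 0 else ⟨1 + n % 3, by omega⟩

/-- The color of a vertex of a component. -/
def compColor (z : ZMod 3) (r : Bool) : Fin 10 :=
  ⟨4 + z.val + (if r then 3 else 0), by have := ZMod.val_lt z; split_ifs <;> omega⟩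

theorem compColor_inj {z z' : ZMod 3} {r r' : Bool} :
    compColor z r = compColor z' r' ↔ z = z' ∧ r = r' := by
  revert z z' r r'; decide

theorem nodeColor_ne_compColor (n : ℕ) (z : ZMod 3) (r : Bool) : nodeColor n ≠ compColor z r := by
  have := Nat.mod_lt n (by norm_num : 3 > 0)
  unfold nodeColor compColor
  split_ifs <;> simp [Fin.ext_iff] <;> omega

theorem nodeColor_eq_zero {n : ℕ} : nodeColor n = 0 ↔ n = 0 := by
  unfold nodeColor
  split_ifs with h <;> simp [Fin.ext_iff, h]

theorem nodeColor_ne_add_two (n : ℕ) : nodeColor n ≠ nodeColor (n + 2) := by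
  unfold nodeColor
  split_ifs <;> simp [Fin.ext_iff] <;> omega

variable {m p q : ℕ}

/-- The edges of the graph, directed away from the root and along the cycles. -/
inductive Arc : Vert m p q → Vert m p q → Prop
  | child (k : Bool) (s s' : {s : List Bool // s.length ≤ m}) (c : Bool) (h : s'.1 = c :: s.1) :
      Arc (k, s, none) (k, s', none)
  | enter (k : Bool) (s : {s : List Bool // s.length ≤ m}) (w : Comp p q) :
      Arc (k, s, none) (k, s, some w)
  | cycle (k : Bool) (s : {s : List Bool // s.length ≤ m}) (x x' : ZMod (3 * p))
      (h : x' = x + 1) : Arc (k, s, some (.inl x)) (k, s, some (.inl x'))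
  | doubledCycle (k : Bool) (s : {s : List Bool // s.length ≤ m}) (y y' : ZMod (3 * q))
      (c c' : Bool) (h : y' = y + 1) :
      Arc (k, s, some (.inr (y, c))) (k, s, some (.inr (y', c')))

theorem ne_add_one (x : ZMod (3 * p)) : x ≠ x + 1 := by
  intro h
  have := congrArg (cls p) h
  simp at this

theorem Arc.irrefl (u : Vert m p q) : ¬ Arc u u := by
  rintro h
  generalize hv : u = v at h
  have h' : Arc u v := hv ▸ h
  cases h' with
  | child k s s' c h1 => simp only [Prod.mk.injEq, and_true, true_and] at hv; subst hv; simp at h1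
  | enter => simp at hv
  | cycle k s x x' h1 =>
    simp only [Prod.mk.injEq, Option.some.injEq, Sum.inl.injEq, true_and] at hv
    exact ne_add_one x (hv.trans h1)
  | doubledCycle k s y y' c c' h1 =>
    simp only [Prod.mk.injEq, Option.some.injEq, Sum.inr.injEq, true_and] at hv
    exact ne_add_one y (hv.1.trans h1)

/-- The underlying graph. -/
def baseGraph (m p q : ℕ) : SimpleGraph (Vert m p q) where
  Adj u v := Arc u v ∨ Arc v u
  symm := ⟨fun _ _ h => h.symm⟩
  loopless := ⟨fun u h => Arc.irrefl u (h.elim id id)⟩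

theorem baseGraph_adj {u v : Vert m p q} :
    (baseGraph m p q).Adj u v ↔ Arc u v ∨ Arc v u := Iff.rfl

/-- The color of a vertex in the component of the node `s`, or of the node itself. -/
def colorOf (m : ℕ) (b : Bool) (s : List Bool) : Option (Comp p q) → Fin 10
  | none => nodeColor s.length
  | some (.inl x) => compColor (cls p x) (decide (x = 0) && special m b s)
  | some (.inr (y, c)) => compColor (cls q y) (c && decide (y ≠ 0))

/-- The colored graph with root type `b`. -/
def treeGraph (m p q : ℕ) (b : Bool) : ColoredGraph 10 (Vert m p q) where
  graph := baseGraph m p q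
  color u := colorOf m b u.2.1.1 u.2.2

/-! ### Duplicator's strategy -/

/-- The pairs of types allowed for nodes at distance `l` from the root when Spoiler, who plays next
on the side of the first node, has `j` alternations left. -/
def TypeOk (m j l : ℕ) (x y : Bool) : Prop :=
  (x = true → y = false → j + l ≤ m) ∧ (x = false → y = true → j + l + 1 ≤ m)

/-- All pairs of types on the paths to the root are allowed. -/
def Anc (m : ℕ) (b b' : Bool) (j : ℕ) : List Bool → List Bool → Prop
  | [], [] => TypeOk m j 0 b b'
  | c :: s, d :: s' =>
    TypeOk m j (s.length + 1) (ty b (c :: s)) (ty b' (d :: s')) ∧ Anc m b b' j s s'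
  | _, _ => False

theorem Anc.length_eq {b b' : Bool} {j : ℕ} {s s' : List Bool} (h : Anc m b b' j s s') :
    s.length = s'.length := by
  induction s generalizing s' with
  | nil => cases s' <;> simp_all [Anc]
  | cons c s ih =>
    cases s' with
    | nil => simp [Anc] at h
    | cons d s' => simpa using ih h.2

theorem Anc.typeOk {b b' : Bool} {j : ℕ} {s s' : List Bool} (h : Anc m b b' j s s') :
    TypeOk m j s.length (ty b s) (ty b' s') := by
  cases s <;> cases s' <;> simp_all [Anc, ty]

theorem TypeOk.swap {j l : ℕ} {x y : Bool} (h : TypeOk m (j + 1) l x y) : TypeOk m j l y x := by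
  constructor <;> intro h1 h2
  · have := h.2 h2 h1; omega
  · have := h.1 h2 h1; omega

theorem Anc.swap {b b' : Bool} {j : ℕ} {s s' : List Bool} (h : Anc m b b' (j + 1) s s') :
    Anc m b' b j s' s := by
  induction s generalizing s' with
  | nil =>
    cases s' with
    | nil => exact TypeOk.swap h
    | cons => simp [Anc] at h
  | cons c s ih =>
    cases s' with
    | nil => simp [Anc] at h
    | cons d s' => exact ⟨h.2.length_eq ▸ TypeOk.swap h.1, ih h.2⟩

/-- Duplicator answers a `false` child by a `false` child, which always exists. A `true` child has a
`false` parent; the second child is then an equal answer unless the parents form the pair (`false`,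
`true`), and in that case the stricter bound at the parents is the bound needed for (`true`,
`false`) one level lower. -/
theorem Anc.child {b b' : Bool} {j : ℕ} {s s' : List Bool} (h : Anc m b b' j s s') (c : Bool) :
    ∃ d, Anc m b b' j (c :: s) (d :: s') := by
  have ht := h.typeOk
  by_cases hc : ty b (c :: s) = true
  · refine ⟨true, ⟨fun h1 h2 => ?_, fun h1 h2 => ?_⟩, h⟩
    · have h3 : ty b s = false := by simp [ty] at h1; exact h1.2
      have h4 : ty b' s' = true := by simpa [ty] using h2
      have := ht.2 h3 h4
      omega
    · simp [h1] at hc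
  · refine ⟨false, ⟨fun h1 h2 => absurd h1 hc, fun h1 h2 => ?_⟩, h⟩
    simp [ty] at h2

theorem Anc.exists_of_start {b b' : Bool} {j : ℕ} (h : TypeOk m j 0 b b') (s : List Bool) :
    ∃ s', Anc m b b' j s s' := by
  induction s with
  | nil => exact ⟨[], h⟩
  | cons c s ih =>
    obtain ⟨s', hs'⟩ := ih
    obtain ⟨d, hd⟩ := hs'.child c
    exact ⟨_, hd⟩

/-! ### Duplicator's play inside the gadgets -/

/-- The vertex of the doubled cycle that answers the vertex `T` of the cycle of length `3p`. -/
def answer (p q : ℕ) (T : ℤ) : Comp p q :=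
  .inr ((T : ZMod (3 * q)), decide ((T : ZMod (3 * p)) = 0))

/-- Allowed pairs of vertices in the components of a pair of nodes. -/
inductive PairRel (p q : ℕ) : Bool → Bool → ℕ → ℕ → Option (Comp p q) → Option (Comp p q) → Prop
  | same (x y : Bool) (j t : ℕ) (o : Option (Comp p q)) (h : x = y ∨ ∀ z, o ≠ some (.inl z)) :
      PairRel p q x y j t o o
  | shift (t : ℕ) (T : ℤ) (h : (t : ℤ) < T) (h' : T + t < 3 * p * q) :
      PairRel p q true false 0 t (some (.inl (T : ZMod (3 * p)))) (some (answer p q T))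

/-- Duplicator's invariant. -/
structure Inv (b b' : Bool) (j t : ℕ) (u v : Vert m p q) : Prop where
  anc : Anc m b b' j u.2.1.1 v.2.1.1
  comp : PairRel p q (special m b u.2.1.1) (special m b' v.2.1.1) j t u.2.2 v.2.2

/-- At distance `m` from the root `TypeOk` excludes the pair (`false`, `true`) and allows (`true`,
`false`) only with no alternation left. -/
theorem special_cases {b b' : Bool} {j : ℕ} {s s' : List Bool} (h : Anc m b b' j s s') :
    special m b s = special m b' s' ∨
      (special m b s = true ∧ special m b' s' = false ∧ j = 0) := by
  have h1 := h.typeOk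
  have h2 := h.length_eq
  unfold special
  rw [← h2]
  by_cases hl : s.length = m
  · simp only [hl, decide_true, Bool.true_and]
    cases hx : ty b s <;> cases hy : ty b' s' <;> simp
    · have := h1.2 hx hy; omega
    · have := h1.1 hx hy; omega
  · simp [hl]

/-- A `shift` pair occurs only at index 0, so it never has to survive a change of sides. -/
theorem PairRel.swap {x y : Bool} {j t : ℕ} {o o' : Option (Comp p q)}
    (h : PairRel p q x y (j + 1) t o o') : PairRel p q y x j t o' o := by
  cases h with
  | same _ _ _ _ _ h => exact .same _ _ _ _ _ (h.imp_left Eq.symm)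

theorem PairRel.weaken {x y : Bool} {j t : ℕ} {o o' : Option (Comp p q)}
    (h : PairRel p q x y j (t + 1) o o') : PairRel p q x y j t o o' := by
  cases h with
  | same _ _ _ _ _ h => exact .same _ _ _ _ _ h
  | shift _ T h h' => push_cast at h h'; exact .shift _ T (by omega) (by omega)

theorem cls_intCast (T : ℤ) : cls p (T : ZMod (3 * p)) = (T : ZMod 3) := map_intCast _ _

/-- The two cycles meet again only after `3pq` steps. -/
theorem not_both_zero (hpq : p.Coprime q) {T : ℤ} (h0 : 0 < T) (h1 : T < 3 * p * q)
    (hp : (T : ZMod (3 * p)) = 0) : (T : ZMod (3 * q)) ≠ 0 := by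
  intro hq
  rw [ZMod.intCast_zmod_eq_zero_iff_dvd] at hp hq
  obtain ⟨a, rfl⟩ : (3 : ℤ) ∣ T := dvd_trans (by push_cast; exact Dvd.intro _ rfl) hp
  push_cast at hp hq
  have hp' : (p : ℤ) ∣ a := (mul_dvd_mul_iff_left (by norm_num)).1 hp
  have hq' : (q : ℤ) ∣ a := (mul_dvd_mul_iff_left (by norm_num)).1 hq
  have := (Nat.isCoprime_iff_coprime.2 hpq).mul_dvd hp' hq'
  have := Int.le_of_dvd (by omega) this
  nlinarith

/-- In a `shift` pair the answer carries the required mark unless it sits at position 0 of the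
doubled cycle when a mark is due. As `0 < T < 3pq`, that never happens. -/
theorem Inv.color_eq (hpq : p.Coprime q) {b b' : Bool} {j t : ℕ} {u v : Vert m p q}
    (h : Inv b b' j t u v) : (treeGraph m p q b).color u = (treeGraph m p q b').color v := by
  obtain ⟨k, ⟨s, hs⟩, o⟩ := u
  obtain ⟨k', ⟨s', hs'⟩, o'⟩ := v
  obtain ⟨h1, h2⟩ := h
  simp only [treeGraph] at h1 h2 ⊢
  generalize hx : special m b s = x at h2
  generalize hy : special m b' s' = y at h2
  cases h2 with
  | same _ _ _ _ _ h =>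
    rcases o with _ | z | z
    · simp [colorOf, h1.length_eq]
    · rcases h with h | h
      · simp [colorOf, hx, hy, h]
      · exact absurd rfl (h z)
    · rfl
  | shift _ T h h' =>
    simp only [colorOf, answer, cls_intCast, compColor_inj, true_and, hx, Bool.and_true]
    by_cases hT : (T : ZMod (3 * p)) = 0
    · simp [hT, not_both_zero hpq (by omega) (by omega) hT]
    · simp [hT]

/-- Duplicator's answer when Spoiler moves into a component. -/
theorem exists_pairRel {r : ℕ} (hr : 2 ≤ r) {t : ℕ} (ht : t ≤ r ^ 2) {x y : Bool} {j : ℕ}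
    (h : x = y ∨ (x = true ∧ y = false ∧ j = 0)) (w : Comp (2 * r + 1) (2 * r)) :
    ∃ w', PairRel (2 * r + 1) (2 * r) x y j t (some w) (some w') := by
  rcases w with z | z
  · rcases h with h | ⟨rfl, rfl, rfl⟩
    · exact ⟨_, .same _ _ _ _ _ (.inl h)⟩
    -- Of all lifts of `z`, one near the middle of `(0, 3pq)` is chosen: adding `r` turns of the
    -- simple cycle, with `q = 2r`, leaves more than `r ^ 2` steps on both sides once `r ≥ 2`.
    · have hz : (((z.val : ℤ) + (3 * (2 * r + 1) : ℕ) * r : ℤ) : ZMod (3 * (2 * r + 1))) = z := by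
        rw [Int.cast_add, Int.cast_mul, Int.cast_natCast, Int.cast_natCast, ZMod.natCast_self]
        simp
      have hlt : (z.val : ℤ) < (3 * (2 * r + 1) : ℕ) := by exact_mod_cast ZMod.val_lt z
      have h0 : (0 : ℤ) ≤ z.val := by positivity
      have hr' : (2 : ℤ) ≤ r := by exact_mod_cast hr
      have ht' : (t : ℤ) ≤ r ^ 2 := by exact_mod_cast ht
      generalize hT : ((z.val : ℤ) + (3 * (2 * r + 1) : ℕ) * r : ℤ) = T at hz
      push_cast at hlt hT
      subst hz
      refine ⟨_, .shift t T ?_ ?_⟩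
      · nlinarith
      · push_cast; nlinarith
  · exact ⟨_, .same _ _ _ _ _ (.inr (by simp))⟩

theorem PairRel.step {x y : Bool} {j t : ℕ} {k k' : Bool} {s s' : {s : List Bool // s.length ≤ m}}
    {w w' z : Comp p q} (h : PairRel p q x y j (t + 1) (some w) (some z))
    (ha : (baseGraph m p q).Adj (k, s, some w) (k, s, some w')) :
    ∃ z', (baseGraph m p q).Adj (k', s', some z) (k', s', some z') ∧
      PairRel p q x y j t (some w') (some z') := by
  cases h with
  | same _ _ _ _ _ h =>
    refine ⟨w', ?_, .same _ _ _ _ _ (h.imp_right fun h a => ?_)⟩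
    · rcases baseGraph_adj.1 ha with ha | ha <;> cases ha
      · exact .inl (.cycle _ _ _ _ ‹_›)
      · exact .inl (.doubledCycle _ _ _ _ _ _ ‹_›)
      · exact .inr (.cycle _ _ _ _ ‹_›)
      · exact .inr (.doubledCycle _ _ _ _ _ _ ‹_›)
    · rcases baseGraph_adj.1 ha with ha | ha <;> cases ha <;> simp at h ⊢
  | shift _ T h h' =>
    push_cast at h h'
    rcases baseGraph_adj.1 ha with ha | ha
    · cases ha with
      | cycle _ _ _ x' hx =>
        have hx' : x' = ((T + 1 : ℤ) : ZMod (3 * p)) := by simp [hx]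
        subst hx'
        exact ⟨_, .inl (.doubledCycle _ _ _ _ _ _ (by simp)),
          .shift t (T + 1) (by omega) (by omega)⟩
    · cases ha with
      | cycle _ _ x' _ hx =>
        have hx' : x' = ((T - 1 : ℤ) : ZMod (3 * p)) := by simp [hx]
        subst hx'
        exact ⟨_, .inr (.doubledCycle _ _ _ _ _ _ (by simp)),
          .shift t (T - 1) (by omega) (by omega)⟩

theorem PairRel.none_left {x y : Bool} {j t : ℕ} {o : Option (Comp p q)}
    (h : PairRel p q x y j t none o) : o = none := by
  cases h; rfl

theorem PairRel.some_left {x y : Bool} {j t : ℕ} {w : Comp p q} {o : Option (Comp p q)}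
    (h : PairRel p q x y j t (some w) o) : ∃ w', o = some w' := by
  cases h <;> exact ⟨_, rfl⟩

theorem Inv.extend {r : ℕ} (hr : 2 ≤ r) {b b' : Bool} {j t : ℕ}
    {u v u' : Vert m (2 * r + 1) (2 * r)} (h : Inv b b' j (t + 1) u v) (ht : t + 1 ≤ r ^ 2)
    (ha : (baseGraph m (2 * r + 1) (2 * r)).Adj u u') :
    ∃ v', (baseGraph m (2 * r + 1) (2 * r)).Adj v v' ∧ Inv b b' j t u' v' := by
  obtain ⟨k', ⟨s', hs'⟩, o'⟩ := v
  obtain ⟨h1, h2⟩ := h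
  have hnone : ∀ x y, PairRel (2 * r + 1) (2 * r) x y j t none none :=
    fun x y => .same _ _ _ _ _ (.inr (by simp))
  rcases baseGraph_adj.1 ha with ha | ha
  · cases ha with
    | child k s s'' c hc =>
      obtain rfl := h2.none_left
      obtain ⟨d, hd⟩ := h1.child c
      have hl := h1.length_eq
      have hl' := s''.2
      simp only [hc, List.length_cons] at hl hl'
      refine ⟨(k', ⟨d :: s', by simp; omega⟩, none), .inl (.child _ _ _ d rfl), ?_, hnone _ _⟩
      simpa [hc] using hd
    | enter k s w =>
      obtain rfl := h2.none_left
      obtain ⟨w', hw'⟩ := exists_pairRel hr (by omega : t ≤ r ^ 2) (special_cases h1) w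
      exact ⟨(k', ⟨s', hs'⟩, some w'), .inl (.enter _ _ _), h1, hw'⟩
    | cycle k s x x' hx =>
      obtain ⟨w, rfl⟩ := h2.some_left
      obtain ⟨z, hz, hz'⟩ := h2.step (k := k) (s := s) (k' := k') (s' := ⟨s', hs'⟩)
        (.inl (.cycle _ _ _ _ hx))
      exact ⟨_, hz, h1, hz'⟩
    | doubledCycle k s y y' c c' hy =>
      obtain ⟨w, rfl⟩ := h2.some_left
      obtain ⟨z, hz, hz'⟩ := h2.step (k := k) (s := s) (k' := k') (s' := ⟨s', hs'⟩)
        (.inl (.doubledCycle _ _ _ _ _ c' hy))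
      exact ⟨_, hz, h1, hz'⟩
  · cases ha with
    | child k s s'' c hc =>
      obtain rfl := h2.none_left
      simp only [hc] at h1
      cases s' with
      | nil => simp [Anc] at h1
      | cons d s' =>
        -- Moving up is safe because `Anc` constrains the whole path to the root.
        exact ⟨(k', ⟨s', by simp at hs'; omega⟩, none), .inr (.child _ _ _ d rfl), h1.2,
          hnone _ _⟩
    | enter k s w =>
      obtain ⟨w, rfl⟩ := h2.some_left
      exact ⟨(k', ⟨s', hs'⟩, none), .inr (.enter _ _ _), h1, hnone _ _⟩
    | cycle k s x x' hx =>
      obtain ⟨w, rfl⟩ := h2.some_left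
      obtain ⟨z, hz, hz'⟩ := h2.step (k := k) (s := s) (k' := k') (s' := ⟨s', hs'⟩)
        (.inr (.cycle _ _ _ _ hx))
      exact ⟨_, hz, h1, hz'⟩
    | doubledCycle k s y y' c c' hy =>
      obtain ⟨w, rfl⟩ := h2.some_left
      obtain ⟨z, hz, hz'⟩ := h2.step (k := k) (s := s) (k' := k') (s' := ⟨s', hs'⟩)
        (.inr (.doubledCycle _ _ _ _ c _ hy))
      exact ⟨_, hz, h1, hz'⟩

theorem Arc.copy_eq {u v : Vert m p q} (h : Arc u v) : u.1 = v.1 := by cases h <;> rfl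

theorem Inv.jump {r : ℕ} (hr : 2 ≤ r) {b b' : Bool} {j t : ℕ} (u v : Vert m (2 * r + 1) (2 * r))
    (hs : TypeOk m j 0 b b') (ht : t ≤ r ^ 2) :
    ∃ v', v' ≠ v ∧ ¬ (baseGraph m (2 * r + 1) (2 * r)).Adj v v' ∧ Inv b b' j t u v' := by
  obtain ⟨k, ⟨s, hl⟩, o⟩ := u
  obtain ⟨s', hs'⟩ := Anc.exists_of_start hs s
  obtain ⟨o', ho'⟩ : ∃ o',
      PairRel (2 * r + 1) (2 * r) (special m b s) (special m b' s') j t o o' := by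
    rcases o with _ | w
    · exact ⟨none, .same _ _ _ _ _ (.inr (by simp))⟩
    · obtain ⟨w', hw'⟩ := exists_pairRel hr ht (special_cases hs') w
      exact ⟨_, hw'⟩
  -- Answering in the other copy of the tree keeps the new pebble distinct from `v` and not adjacent
  -- to it.
  refine ⟨(!v.1, ⟨s', hs'.length_eq ▸ hl⟩, o'), ?_, ?_, hs', ho'⟩
  · intro h
    have := congrArg Prod.fst h
    simp at this
  · rw [baseGraph_adj]
    rintro (h | h) <;> simpa using h.copy_eq

/-- Duplicator's strategy on the graphs with root types `true` and `false`. -/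
def duplicator (m : ℕ) {r : ℕ} (hr : 2 ≤ r) :
    Strategy (treeGraph m (2 * r + 1) (2 * r)) (r ^ 2) where
  start b b' j := TypeOk m j 0 b b'
  rel := Inv
  start_swap := TypeOk.swap
  rel_swap h := ⟨h.anc.swap, h.comp.swap⟩
  rel_weaken h := ⟨h.anc, h.comp.weaken⟩
  color_eq := Inv.color_eq (by simp)
  extend h ht ha := h.extend hr ht ha
  jump u v h ht := Inv.jump hr u v h ht

theorem le_distDepth_piLevel (m : ℕ) {r : ℕ} (hr : 2 ≤ r) :
    ((r ^ 2 : ℕ) : ℕ∞) ≤ distDepth (PiLevel 10 2 (m + 1)) (treeGraph m (2 * r + 1) (2 * r) false)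
      (treeGraph m (2 * r + 1) (2 * r) true) := by
  have : Nonempty (Vert m (2 * r + 1) (2 * r)) := ⟨(true, ⟨[], by simp⟩, none)⟩
  refine le_iInf₂ fun φ hφ => ?_
  have hs : (duplicator m hr).start true false m := ⟨by simp, by simp⟩
  exact_mod_cast ((duplicator m hr).lt_depth hs (Nat.lt_succ_iff.1 hφ.1.2) hφ.2).le

end Construction

end AltHier

namespace AltHier

/-! ### Distinguishing sentences -/

section Sentences

variable {m p q : ℕ}

/-- With a formula `F` recognizing the leaves of type `true`, a formula recognizing the nodes of
type `false` at distance `l` from the root and distance `h` from the leaves. -/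
def nodeTest (F : Fin 2 → Formula 10 2) : ℕ → ℕ → Fin 2 → Formula 10 2
  | 0, _ => fun x => (F x).dual
  | h + 1, l => dia (nodeColor (l + 1)) (fun x => (nodeTest F h (l + 1) x).dual)

theorem isUnary_nodeTest {F : Fin 2 → Formula 10 2} (hF : IsUnary F) (h l : ℕ) :
    IsUnary (nodeTest F h l) := by
  induction h generalizing l with
  | zero => exact isUnary_dual hF
  | succ h ih => exact isUnary_dia (isUnary_dual (ih _))

theorem altAfter_ex_dia (j : Fin 10) (F : Fin 2 → Formula 10 2) (x : Fin 2) :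
    (dia j F x).altAfter .ex = (F (x + 1)).altAfter .ex := by
  simp [dia, Formula.altAfter]

/-- Each level adds an existential quantifier before a negated test, hence one alternation. -/
theorem altAfter_all_nodeTest {F : Fin 2 → Formula 10 2} {a : ℕ}
    (hF : ∀ x, (F x).altAfter .ex ≤ a) (h l : ℕ) (x : Fin 2) :
    (nodeTest F h l x).altAfter .all ≤ h + a := by
  induction h generalizing l x with
  | zero => simpa [nodeTest, Formula.altAfter_dual, Quantifier.dual] using hF x
  | succ h ih =>
    have h1 := (nodeTest F (h + 1) l x).altAfter_le .all .ex
    have h2 := ih (l + 1) (x + 1)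
    rw [nodeTest, altAfter_ex_dia, Formula.altAfter_dual, Quantifier.dual] at h1
    rw [nodeTest]
    omega

theorem altAfter_ex_nodeTest {F : Fin 2 → Formula 10 2} {a : ℕ}
    (hF : ∀ x, (F x).altAfter .ex ≤ a) (h l : ℕ) (x : Fin 2) :
    (nodeTest F (h + 1) l x).altAfter .ex ≤ h + a := by
  rw [nodeTest, altAfter_ex_dia, Formula.altAfter_dual, Quantifier.dual]
  exact altAfter_all_nodeTest hF _ _ _

/-- `F` recognizes the leaves of type `true`. -/
def LeafTest (m p q : ℕ) (F : Fin 2 → Formula 10 2) : Prop :=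
  ∀ b, ∃ P, Defines (treeGraph m p q b) F P ∧
    ∀ k (s : {s : List Bool // s.length ≤ m}), s.1.length = m →
      (P (k, s, none) ↔ ty b s.1 = true)

/-- Distance modulo 3, with a separate color for the root, tells children from the parent, and
gadget vertices use other colors. -/
theorem adj_and_color_iff (b k : Bool) (s : {s : List Bool // s.length ≤ m}) (w : Vert m p q) :
    (treeGraph m p q b).graph.Adj (k, s, none) w ∧
      (treeGraph m p q b).color w = nodeColor (s.1.length + 1) ↔
    ∃ (c : Bool) (s' : {s : List Bool // s.length ≤ m}), s'.1 = c :: s.1 ∧ w = (k, s', none) := by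
  constructor
  · rintro ⟨ha, hc⟩
    rcases baseGraph_adj.1 ha with ha | ha
    · cases ha with
      | child k s s' c h => exact ⟨c, s', h, rfl⟩
      | enter k s w =>
        rcases w with w | w <;> exact absurd hc.symm (nodeColor_ne_compColor _ _ _)
    · cases ha with
      | child k s' s c h =>
        simp only [treeGraph, colorOf, h, List.length_cons] at hc
        exact absurd hc (nodeColor_ne_add_two _)
  · rintro ⟨c, s', h, rfl⟩
    exact ⟨baseGraph_adj.2 (.inl (.child _ _ _ c h)), by simp [treeGraph, colorOf, h]⟩

theorem exists_defines_nodeTest {F : Fin 2 → Formula 10 2} (hF : LeafTest m p q F) (b : Bool)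
    (h l : ℕ) : ∃ P, Defines (treeGraph m p q b) (nodeTest F h l) P ∧
      ∀ k (s : {s : List Bool // s.length ≤ m}), s.1.length = l → l + h = m →
        (P (k, s, none) ↔ ty b s.1 = false) := by
  induction h generalizing l with
  | zero =>
    obtain ⟨P, hP, h⟩ := hF b
    refine ⟨_, defines_dual hP, fun k s hs hm => ?_⟩
    rw [h k s (by omega), Bool.not_eq_true]
  | succ h ih =>
    obtain ⟨P, hP, h'⟩ := ih (l + 1)
    refine ⟨_, defines_dia (defines_dual hP), ?_⟩
    rintro k s rfl hm
    simp only [← and_assoc, adj_and_color_iff]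
    constructor
    · rintro ⟨w, ⟨c, s', hs', rfl⟩, hw⟩
      rw [h' k s' (by simp [hs']) (by omega), hs'] at hw
      simp only [ty, Bool.not_eq_false, Bool.and_eq_true] at hw
      simpa using hw.2
    · intro hs
      refine ⟨_, ⟨true, ⟨true :: s.1, by simp; omega⟩, rfl, rfl⟩, ?_⟩
      rw [h' k _ (by simp) (by omega)]
      simp [ty, hs]

/-- A sentence distinguishing the two graphs of height `m`. -/
def separator (F : Fin 2 → Formula 10 2) (m : ℕ) : Formula 10 2 := someVertex 0 (nodeTest F m 0)

theorem distinguishes_separator {F : Fin 2 → Formula 10 2} (hF : LeafTest m p q F)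
    (hF' : IsUnary F) :
    Distinguishes (separator F m) (treeGraph m p q false) (treeGraph m p q true) := by
  refine ⟨freeVars_someVertex (isUnary_nodeTest hF' _ _), fun v => ?_, fun v => ?_⟩
  · obtain ⟨P, hP, h⟩ := exists_defines_nodeTest hF false m 0
    refine (holds_someVertex hP v).2 ⟨(true, ⟨[], by simp⟩, none), ?_, ?_⟩
    · simp [treeGraph, colorOf, nodeColor]
    · exact (h _ _ rfl (by simp)).2 rfl
  · obtain ⟨P, hP, h⟩ := exists_defines_nodeTest hF true m 0
    rw [separator, holds_someVertex hP v]
    rintro ⟨⟨k, s, o⟩, hc, hw⟩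
    have h0 : nodeColor 0 = 0 := rfl
    rcases o with _ | w | w
    · have hs : s.1.length = 0 := nodeColor_eq_zero.1 hc
      have := (h k s hs (by simp)).1 hw
      simp [List.length_eq_zero_iff.1 hs, ty] at this
    · exact nodeColor_ne_compColor 0 _ _ (h0.trans hc.symm)
    · exact nodeColor_ne_compColor 0 _ _ (h0.trans hc.symm)

/-- For `m ≥ 1` the quantifier choosing the root and the one choosing its child are both
existential, so the top level is free and `m - 1 + a` alternations suffice. -/
theorem separator_mem {F : Fin 2 → Formula 10 2} {a i : ℕ} (hF : ∀ x, (F x).altAfter .ex ≤ a)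
    (h : m + 1 + a ≤ i + 1) (hm : 1 ≤ m) : separator F m ∈ SigmaLevel 10 2 i := by
  obtain ⟨n, rfl⟩ : ∃ n, m = n + 1 := ⟨m - 1, by omega⟩
  refine ⟨rfl, ?_⟩
  have := altAfter_ex_nodeTest hF n 0 0
  simp only [separator, someVertex, Formula.altAfter, if_true]
  omega

theorem distDepth_le_separator {F : Fin 2 → Formula 10 2} {a i : ℕ} (hL : LeafTest m p q F)
    (hu : IsUnary F) (hF : ∀ x, (F x).altAfter .ex ≤ a) (h : m + 1 + a ≤ i + 1) (hm : 1 ≤ m) :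
    distDepth (SigmaLevel 10 2 i) (treeGraph m p q false) (treeGraph m p q true) ≤
      ((separator F m).depth : ℕ∞) :=
  iInf₂_le _ ⟨separator_mem hF h hm, distinguishes_separator hL hu⟩

/-! ### A shallow sentence with one more alternation -/

/-- The predecessor of the special vertex has no uncolored successor. -/
def shallowTest : Fin 2 → Formula 10 2 := dia (compColor 2 false) (noNeighbor (compColor 0 false))

theorem isUnary_shallowTest : IsUnary shallowTest := isUnary_dia (isUnary_noNeighbor _)

theorem altAfter_shallowTest (x : Fin 2) : (shallowTest x).altAfter .ex ≤ 1 := by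
  simp [shallowTest, dia, noNeighbor, Formula.altAfter]

theorem special_of_length {s : List Bool} (h : s.length = m) (b : Bool) :
    special m b s = ty b s := by
  simp [special, h]

theorem shallowTest_leafTest : LeafTest m p q shallowTest := by
  intro b
  refine ⟨_, defines_dia (defines_noNeighbor _ _), fun k s hs => ?_⟩
  have hsp := special_of_length hs b
  constructor
  · rintro ⟨w, ha, hc, hw⟩
    rcases baseGraph_adj.1 ha with ha | ha
    · cases ha with
      | child => exact absurd hc (nodeColor_ne_compColor _ _ _)
      | enter k s w =>
        rcases w with x | ⟨y, c⟩
        · have h1 := hw (k, s, some (.inl (x + 1))) (baseGraph_adj.2 (.inl (.cycle _ _ _ _ rfl)))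
          simp only [treeGraph, colorOf, compColor_inj] at hc
          simp only [treeGraph, colorOf, ne_eq, compColor_inj, map_add, hc.1, map_one] at h1
          by_contra hty
          exact h1 ⟨by decide, by simp [hsp, Bool.eq_false_iff.2 hty]⟩
        -- Every position of the doubled cycle has an unmarked vertex, so the test never succeeds
        -- there.
        · have h1 := hw (k, s, some (.inr (y + 1, false)))
            (baseGraph_adj.2 (.inl (.doubledCycle _ _ _ _ _ _ rfl)))
          simp only [treeGraph, colorOf, compColor_inj] at hc
          simp only [treeGraph, colorOf, ne_eq, compColor_inj, map_add, hc.1, map_one] at h1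
          exact absurd ⟨by decide, rfl⟩ h1
    · cases ha with
      | child => exact absurd hc (nodeColor_ne_compColor _ _ _)
  · intro hty
    refine ⟨(k, s, some (.inl (-1))), baseGraph_adj.2 (.inl (.enter _ _ _)), ?_, ?_⟩
    · have h1 : (-1 : ZMod (3 * p)) ≠ 0 := by
        intro h
        have := congrArg (cls p) h
        simp at this
      simp only [treeGraph, colorOf, compColor_inj, h1, map_neg, map_one]
      exact ⟨by decide, rfl⟩
    · intro w ha
      rcases baseGraph_adj.1 ha with ha | ha
      · cases ha with
        | cycle k s x x' hx =>
          simp [treeGraph, colorOf, compColor_inj, hx, hsp, hty]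
      · cases ha with
        | enter => exact nodeColor_ne_compColor _ _ _
        | cycle k s x x' hx =>
          have hx' : cls p x = 1 := by
            have h1 : x = -1 - 1 := eq_sub_of_add_eq hx.symm
            rw [h1, map_sub, map_neg, map_one]
            decide
          simp [treeGraph, colorOf, compColor_inj, hx']

/-! ### A deep sentence with few alternations -/

/-- The color of the vertex `T` of the cycle with a special vertex. -/
def cycleColor (p T : ℕ) : Fin 10 := compColor T (decide (3 * p ∣ T))

/-- There is a walk of `n` steps which, color by color, goes on like the cycle with a special vertex
after its vertex `T`. -/
def walk (p : ℕ) : ℕ → ℕ → Fin 2 → Formula 10 2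
  | 0, _ => fun x => .pos (.eq x x)
  | n + 1, T => dia (cycleColor p (T + 1)) (walk p n (T + 1))

/-- The property expressed by `walk`. -/
def WalkFrom (p : ℕ) {V : Type*} (G : ColoredGraph 10 V) : ℕ → ℕ → V → Prop
  | 0, _ => fun _ => True
  | n + 1, T => fun u => ∃ w, G.graph.Adj u w ∧ G.color w = cycleColor p (T + 1) ∧
      WalkFrom p G n (T + 1) w

theorem defines_walk {V : Type*} (G : ColoredGraph 10 V) (n T : ℕ) :
    Defines G (walk p n T) (WalkFrom p G n T) := by
  induction n generalizing T with
  | zero => intro v x; simp [walk, Formula.Holds, Atom.Holds, WalkFrom]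
  | succ n ih => exact defines_dia (ih _)

theorem isUnary_walk (n T : ℕ) : IsUnary (walk p n T) := by
  induction n generalizing T with
  | zero => intro x; simp [walk, Formula.freeVars, Atom.vars]
  | succ n ih => exact isUnary_dia (ih _)

theorem altAfter_walk (n T : ℕ) (x : Fin 2) : (walk p n T x).altAfter .ex = 0 := by
  induction n generalizing T x with
  | zero => rfl
  | succ n ih => rw [walk, altAfter_ex_dia, ih]

theorem colorOf_special {b : Bool} {s : List Bool} (hs : special m b s = true) (T : ℕ) :
    colorOf (q := q) m b s (some (.inl (T : ZMod (3 * p)))) = cycleColor p T := by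
  simp [colorOf, cycleColor, hs, ZMod.natCast_eq_zero_iff]

theorem walkFrom_special {b : Bool} (k : Bool) {s : {s : List Bool // s.length ≤ m}}
    (hs : special m b s.1 = true) (n T : ℕ) :
    WalkFrom p (treeGraph m p q b) n T (k, s, some (.inl (T : ZMod (3 * p)))) := by
  induction n generalizing T with
  | zero => trivial
  | succ n ih =>
    exact ⟨_, baseGraph_adj.2 (.inl (.cycle _ _ _ _ (by push_cast; rfl))),
      colorOf_special (q := q) hs (T + 1), ih _⟩

/-- The prescribed colors increase modulo 3, so a walk starting on the doubled cycle can neither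
turn back nor leave to the tree node: it advances one position per step. -/
theorem color_of_walkFrom {b k : Bool} {s : {s : List Bool // s.length ≤ m}} {n T : ℕ}
    {y : ZMod (3 * q)} {c : Bool}
    (hc : colorOf (p := p) m b s.1 (some (.inr (y, c))) = cycleColor p T)
    (h : WalkFrom p (treeGraph m p q b) n T (k, s, some (.inr (y, c)))) (l : ℕ) (hl : l ≤ n) :
    ∃ c', colorOf (p := p) m b s.1 (some (.inr (y + (l : ZMod (3 * q)), c'))) =
      cycleColor p (T + l) := by
  induction l generalizing n T y c with
  | zero => exact ⟨c, by simpa using hc⟩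
  | succ l ih =>
    obtain ⟨n, rfl⟩ : ∃ n', n = n' + 1 := ⟨n - 1, by omega⟩
    obtain ⟨w, ha, hw, h'⟩ := h
    rcases baseGraph_adj.1 ha with ha | ha
    · cases ha with
      | doubledCycle k s y y' c c' hy =>
        obtain ⟨d, hd⟩ := ih hw h' (by omega)
        refine ⟨d, ?_⟩
        rw [show y + ((l + 1 : ℕ) : ZMod (3 * q)) = y' + l by rw [hy]; push_cast; ring, hd,
          show T + 1 + l = T + (l + 1) by omega]
    · cases ha with
      | enter => exact absurd hw (nodeColor_ne_compColor _ _ _)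
      | doubledCycle k s y' y c' c hy =>
        simp only [treeGraph, colorOf, cycleColor, compColor_inj] at hw hc
        have h1 := hc.1
        rw [hy, map_add, map_one, hw.1, Nat.cast_add, Nat.cast_one, add_assoc] at h1
        exact absurd (add_eq_left.1 h1) (by decide)

/-- Some vertex in the component is the start of a long walk colored like the cycle with a special
vertex. -/
def deepTest (p q : ℕ) : Fin 2 → Formula 10 2 := dia (cycleColor p 0) (walk p (3 * p * q) 0)

theorem isUnary_deepTest : IsUnary (deepTest p q) := isUnary_dia (isUnary_walk _ _)

theorem altAfter_deepTest (x : Fin 2) : (deepTest p q x).altAfter .ex ≤ 0 := by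
  rw [deepTest, altAfter_ex_dia, altAfter_walk]

theorem exists_meeting (hpq : p.Coprime q) (hp : p ≠ 0) (hq : q ≠ 0) {y : ZMod (3 * q)}
    (hy : cls q y = 0) : ∃ l ≤ 3 * p * q, 3 * p ∣ l ∧ y + (l : ZMod (3 * q)) = 0 := by
  have : NeZero (3 * q) := ⟨by omega⟩
  have h1 : ((y.val : ℕ) : ZMod 3) = 0 := by
    rw [← hy, ← map_natCast (cls q), ZMod.natCast_zmod_val]
  rw [ZMod.natCast_eq_zero_iff] at h1
  obtain ⟨a, ha⟩ := h1
  -- Here `y` is `3a`, and `a * (q - 1)` stands for `-a` modulo `q` without leaving the natural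
  -- numbers; three times the solution is the meeting time.
  obtain ⟨l, hl⟩ := Nat.chineseRemainder hpq 0 (a * (q - 1))
  have hl2 := Nat.chineseRemainder_lt_mul hpq 0 (a * (q - 1)) hp hq
  refine ⟨3 * (Nat.chineseRemainder hpq 0 (a * (q - 1)) : ℕ), by nlinarith, ?_, ?_⟩
  · exact mul_dvd_mul_left 3 ((Nat.modEq_zero_iff_dvd).1
      (Nat.chineseRemainder hpq 0 (a * (q - 1))).2.1)
  · rw [← ZMod.natCast_zmod_val y, ha, ← Nat.cast_add, ZMod.natCast_eq_zero_iff, ← mul_add]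
    refine mul_dvd_mul_left 3 ((Nat.modEq_zero_iff_dvd).1 ?_)
    refine ((Nat.chineseRemainder hpq 0 (a * (q - 1))).2.2.add_left a).trans ?_
    obtain ⟨q, rfl⟩ : ∃ q', q = q' + 1 := ⟨q - 1, by omega⟩
    exact (Nat.modEq_zero_iff_dvd).2 ⟨a, by simp; ring⟩

theorem deepTest_leafTest (hpq : p.Coprime q) (hp : p ≠ 0) (hq : q ≠ 0) :
    LeafTest m p q (deepTest p q) := by
  intro b
  refine ⟨_, defines_dia (defines_walk _ _ _), fun k s hs => ?_⟩
  have hsp := special_of_length hs b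
  constructor
  · rintro ⟨w, ha, hc, hw⟩
    rcases baseGraph_adj.1 ha with ha | ha
    · cases ha with
      | child => exact absurd hc (nodeColor_ne_compColor _ _ _)
      | enter k s w =>
        rcases w with x | ⟨y, c⟩
        · simp only [treeGraph, colorOf, cycleColor, compColor_inj] at hc
          have h := hc.2
          simp only [hsp, dvd_zero, decide_true, Bool.and_eq_true] at h
          exact h.2
        · have hy : cls q y = 0 := by
            simp only [treeGraph, colorOf, cycleColor, compColor_inj] at hc
            simpa using hc.1
          obtain ⟨l, hl, h1, h2⟩ := exists_meeting hpq hp hq hy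
          obtain ⟨c', hc'⟩ := color_of_walkFrom hc hw l hl
          -- At the meeting time the walk needs a marked vertex, but both vertices at position 0 are
          -- unmarked.
          simp [colorOf, cycleColor, compColor_inj, h1, h2] at hc'
    · cases ha with
      | child => exact absurd hc (nodeColor_ne_compColor _ _ _)
  · intro hty
    exact ⟨(k, s, some (.inl ((0 : ℕ) : ZMod (3 * p)))), baseGraph_adj.2 (.inl (.enter _ _ _)),
      colorOf_special (q := q) (hsp.trans hty) 0, walkFrom_special k (hsp.trans hty) _ 0⟩

end Sentences

/-! ### The size of the graphs -/

theorem card_vert (m : ℕ) {r : ℕ} (hr : r ≠ 0) :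
    Nat.card (Vert m (2 * r + 1) (2 * r)) =
      2 * Nat.card {s : List Bool // s.length ≤ m} * (18 * r + 4) := by
  have : NeZero (3 * (2 * r)) := ⟨by omega⟩
  rw [Nat.card_prod, Nat.card_prod, Finite.card_option, Nat.card_sum, Nat.card_prod, Nat.card_zmod,
    Nat.card_zmod, Nat.card_eq_fintype_card (α := Bool), Fintype.card_bool]
  ring

instance finite_listBool (m : ℕ) : Finite {s : List Bool // s.length ≤ m} :=
  (List.finite_length_le Bool m).to_subtype

theorem card_listBool_pos (m : ℕ) : 0 < Nat.card {s : List Bool // s.length ≤ m} := by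
  have : Nonempty {s : List Bool // s.length ≤ m} := ⟨⟨[], by simp⟩⟩
  exact Nat.card_pos

end AltHier

/-! ### Choice of constants and conclusion -/

open AltHier in
theorem theorem7 :
    ∃ c : ℕ, ∀ i : ℕ, 2 ≤ i →
      ∃ (K : ℕ) (ε : ℝ), 0 < ε ∧
        {n : ℕ | ∃ G H : AltHier.ColoredGraph c (Fin n),
          AltHier.distDepth (AltHier.SigmaLevel c 2 i) G H ≤ (K : ℕ∞) ∧
          AltHier.distDepth (AltHier.SigmaLevel c 2 (i - 1)) G H < ⊤ ∧
          ENNReal.ofReal (ε * (n : ℝ) ^ 2) ≤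
            ((AltHier.distDepth (AltHier.PiLevel c 2 i) G H : ℕ∞) : ℝ≥0∞)}.Infinite := by
  refine ⟨10, fun i hi => ?_⟩
  obtain ⟨m, rfl⟩ : ∃ m, i = m + 1 := ⟨i - 1, by omega⟩
  have hC := card_listBool_pos m
  set C := Nat.card {s : List Bool // s.length ≤ m} with hCdef
  have hC' : (0 : ℝ) < C := by exact_mod_cast hC
  -- `K` depends on `m` only. For `ε`: with `ρ ≥ 2`, the size `2C(18ρ + 4)` is at most `40Cρ`, whose
  -- square is `1600C²ρ²`, against the lower bound `ρ ^ 2`.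
  refine ⟨(separator shallowTest m).depth, 1 / (1600 * (C : ℝ) ^ 2), by positivity, ?_⟩
  refine Set.infinite_of_injective_forall_mem (f := fun r : ℕ => 2 * C * (18 * (r + 2) + 4))
    (fun r r' h => ?_) (fun r => ?_)
  · have := Nat.eq_of_mul_eq_mul_left (by omega) h
    omega
  · obtain ⟨ρ, hρ⟩ : ∃ ρ, ρ = r + 2 := ⟨_, rfl⟩
    have hρ2 : 2 ≤ ρ := by omega
    have : NeZero (3 * (2 * ρ)) := ⟨by omega⟩
    simp only [← hρ, Set.mem_ofPred_eq]
    have e : Vert m (2 * ρ + 1) (2 * ρ) ≃ Fin (2 * C * (18 * ρ + 4)) :=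
      Finite.equivFinOfCardEq (card_vert m (by omega))
    refine ⟨(treeGraph m _ _ false).copy e, (treeGraph m _ _ true).copy e, ?_, ?_, ?_⟩ <;>
      rw [distDepth_copy]
    · exact distDepth_le_separator shallowTest_leafTest isUnary_shallowTest altAfter_shallowTest
        (by omega) (by omega)
    · exact (distDepth_le_separator (deepTest_leafTest (by simp) (by omega) (by omega))
        isUnary_deepTest altAfter_deepTest (by omega) (by omega)).trans_lt (ENat.natCast_lt_top _)
    · refine le_trans ?_ (ENat.toENNReal_le.2 (le_distDepth_piLevel m hρ2))
      rw [ENat.toENNReal_coe, ← ENNReal.ofReal_natCast]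
      refine ENNReal.ofReal_le_ofReal ?_
      have h1 : (2 : ℝ) ≤ ρ := by exact_mod_cast hρ2
      have h2 : (18 * (ρ : ℝ) + 4) ^ 2 ≤ (20 * ρ) ^ 2 := by gcongr; linarith
      push_cast
      rw [div_mul_eq_mul_div, div_le_iff₀ (by positivity)]
      nlinarith [mul_le_mul_of_nonneg_left h2 (by positivity : 0 ≤ 4 * (C : ℝ) ^ 2)]
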